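/- Let $m\ge 1$ be an integer, let $0<p<1$, $q=1-p$ and $r=q/p$. Label the vertices of an $(m+1)$-gon clockwise by $0,1,\dots,m$, where vertex $m+1$ is the same as vertex $0$. A particle starts at vertex $0$ and at each step, independently of its other steps, moves to the adjacent vertex in the clockwise direction with probability $p$ and to the adjacent vertex in the counterclockwise direction with probability $q$. Let $R$ be the additional number of steps that the particle needs to return to vertex $0$, counted from the first moment at which all vertices have been visited. For $1\le i\le m$ let $L_i$ be the event that the last vertex to be visited is $i$, and let $E_{i:m+1}$ be the expected number of bets until a gambler who starts with $i$ dollars, and who in independent bets wins one dollar with probability $p$ or loses one dollar with probability $q$, has either $m+1$ dollars or none. Then $E[R]$ is finite, $$E[R]=\sum_{i=1}^{m}P\{L_i\}\,E_{i:m+1},$$ and $$E[R]=\begin{cases}\dfrac{(m+1)(m+2)}{6} & \text{if } r=1,\\[2ex] \dfrac{r+1}{r-1}\left[\dfrac{r}{r-1}-\dfrac{m(m+2)}{r^m-1}+\dfrac{(m+1)^2}{r^{m+1}-1}\right] & \text{if } r\ne 1.\end{cases}$$ -/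

import Mathlib

open MeasureTheory ProbabilityTheory
open scoped ENNReal

namespace PolygonWalk

/-- `ξ 0, ξ 1, …` are independent steps, each equal to `+1` (a clockwise move, or a bet won) with
probability `p` and to `-1` (a counterclockwise move, or a bet lost) with probability `1 - p`. -/
structure IsStepSequence {Ω : Type*} [MeasurableSpace Ω] (P : Measure Ω) (p : ℝ)
    (ξ : ℕ → Ω → ℤ) : Prop where
  measurable : ∀ k, Measurable (ξ k)
  indep : iIndepFun ξ P
  prob_one : ∀ k, P.real {ω | ξ k ω = 1} = p
  prob_neg_one : ∀ k, P.real {ω | ξ k ω = -1} = 1 - p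

/-- The sum of the first `n` steps of a path. -/
def netSteps {Ω : Type*} (ξ : ℕ → Ω → ℤ) (n : ℕ) (ω : Ω) : ℤ :=
  ∑ k ∈ Finset.range n, ξ k ω

/-- The vertex occupied after `n` moves by the particle that starts at vertex `0` of the
`(m + 1)`-gon. The vertices, labelled clockwise, are the residues modulo `m + 1`. -/
def position (m : ℕ) {Ω : Type*} (ξ : ℕ → Ω → ℤ) (n : ℕ) (ω : Ω) : ZMod (m + 1) :=
  (netSteps ξ n ω : ZMod (m + 1))

/-- `t` is the first time at which all vertices have been visited. -/
def IsCoverTime (m : ℕ) {Ω : Type*} (ξ : ℕ → Ω → ℤ) (ω : Ω) (t : ℕ) : Prop :=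
  IsLeast {n : ℕ | ∀ v : ZMod (m + 1), ∃ k ≤ n, position m ξ k ω = v} t

/-- The event that the last vertex to be visited (for the first time) is `v`. -/
def lastVertexEvent (m : ℕ) {Ω : Type*} (ξ : ℕ → Ω → ℤ) (v : ZMod (m + 1)) : Set Ω :=
  {ω | ∃ t, IsCoverTime m ξ ω t ∧ position m ξ t ω = v}

/-- The number of steps, counted from the moment when all vertices have been visited, until the
particle is at vertex `0`; it is `⊤` if that never happens. -/
noncomputable def additionalSteps (m : ℕ) {Ω : Type*} (ξ : ℕ → Ω → ℤ) (ω : Ω) : ℕ∞ :=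
  ⨅ (n : ℕ) (_ : ∃ t, IsCoverTime m ξ ω t ∧ position m ξ (t + n) ω = 0), (n : ℕ∞)

/-- The number of bets, of one dollar each, until a gambler who starts with `i` dollars has
`0` or `N` dollars; it is `⊤` if that never happens. -/
noncomputable def ruinDuration (i N : ℕ) {Ω : Type*} (ξ : ℕ → Ω → ℤ) (ω : Ω) : ℕ∞ :=
  ⨅ (n : ℕ) (_ : (i : ℤ) + netSteps ξ n ω = 0 ∨ (i : ℤ) + netSteps ξ n ω = N), (n : ℕ∞)

/-- The expectation of a random number of steps, as an extended nonnegative real. -/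
noncomputable def expectedSteps {Ω : Type*} [MeasurableSpace Ω] (P : Measure Ω)
    (T : Ω → ℕ∞) : ℝ≥0∞ :=
  ∫⁻ ω, (T ω : ℝ≥0∞) ∂P

end PolygonWalk

/-!
A path with steps `±1` visits the integers of an interval that contains `0`, so all vertices have
been visited as soon as this interval has length `m`. If `i` is the last vertex to be visited, the
walk on `ℤ`, which covers the walk on the polygon, stands at that time at one of the two adjacent
lifts `i` and `i - (m + 1)` of that vertex. In both cases the return to vertex `0` is the end of a
gambler's ruin problem with initial fortune `i` and goal `m + 1`
(`IsCoverTime.additionalSteps_eq`). The cover time is a stopping time, so summing over its values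
and applying the Markov property `IsStepSequence.setLIntegral_shift` gives the decomposition of
the expectation (`IsStepSequence.expectedSteps_additionalSteps`).

For the law of the last vertex let `A i` be the event that the walk on `ℤ` reaches `i - 1` before
`i - (m + 1)`. These events decrease in `i`, almost surely from the whole space for `i = 1` to the
empty set for `i = m + 1`. If `i` is the last vertex, then `A i` occurs and `A (i + 1)` does not
(`IsCoverTime.mem_ruinWin_diff`). The walk almost surely covers the polygon, so both families
partition the space and agree up to null sets. Hence the probability that `i` is last is the
difference of two winning probabilities in ruin problems with goal `m`
(`IsStepSequence.real_lastVertexEvent`).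

Winning probabilities and expected durations of the ruin problem come from first-step analysis: both
solve a second-order recurrence, whose homogeneous solutions vanishing at `0` are multiples of the
geometric sums with ratio `r` (`eq_mul_geom_sum_of_harmonic`). The durations have finite expectation
because an explicit supersolution dominates their truncations
(`IsStepSequence.lintegral_ruinDuration_min_le`).
-/

namespace PolygonWalk

/-! ### The Markov property of the step sequence -/

/-- The first `t` steps of a path. -/
def firstSteps {Ω : Type*} (ξ : ℕ → Ω → ℤ) (t : ℕ) (ω : Ω) : Fin t → ℤ := fun k => ξ k ω

/-- A path event that is settled by the first `t` steps is the preimage of a set of step vectors;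
there are only countably many of these vectors, so measurability is automatic. -/
theorem exists_firstSteps_preimage {Ω : Type*} {ξ : ℕ → Ω → ℤ} {A : Set Ω} {t : ℕ}
    (hA : ∀ ω ω', (∀ k < t, ξ k ω = ξ k ω') → ω ∈ A → ω' ∈ A) :
    ∃ B : Set (Fin t → ℤ), A = firstSteps ξ t ⁻¹' B := by
  refine ⟨firstSteps ξ t '' A, Set.Subset.antisymm (Set.subset_preimage_image _ _) ?_⟩
  rintro ω' ⟨ω, hω, h⟩
  exact hA ω ω' (fun k hk => congrFun h ⟨k, hk⟩) hω

section Markov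

variable {Ω : Type*} [MeasurableSpace Ω] {P : Measure Ω} {p : ℝ} {ξ : ℕ → Ω → ℤ}

/-- The steps after time `t` form a step sequence again. -/
theorem IsStepSequence.shift (hξ : IsStepSequence P p ξ) (t : ℕ) :
    IsStepSequence P p (fun k => ξ (t + k)) where
  measurable k := hξ.measurable (t + k)
  indep := hξ.indep.precomp (add_right_injective t)
  prob_one k := hξ.prob_one (t + k)
  prob_neg_one k := hξ.prob_neg_one (t + k)

theorem IsStepSequence.measurableSet_step (hξ : IsStepSequence P p ξ) (k : ℕ) (z : ℤ) :
    MeasurableSet {ω | ξ k ω = z} :=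
  hξ.measurable k (measurableSet_singleton z)

theorem IsStepSequence.ae_step [IsProbabilityMeasure P] (hξ : IsStepSequence P p ξ) :
    ∀ᵐ ω ∂P, ∀ k, ξ k ω = 1 ∨ ξ k ω = -1 := by
  rw [ae_all_iff]
  intro k
  have hm1 := hξ.measurableSet_step k 1
  have hm2 := hξ.measurableSet_step k (-1)
  have hd : Disjoint {ω | ξ k ω = 1} {ω | ξ k ω = -1} := by
    rw [Set.disjoint_left]
    intro ω h1 h2
    simp only [Set.mem_ofPred_eq] at h1 h2
    omega
  have h : P.real ({ω | ξ k ω = 1} ∪ {ω | ξ k ω = -1}) = 1 := by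
    rw [measureReal_union hd hm2, hξ.prob_one, hξ.prob_neg_one]
    ring
  rw [← Set.ofPred_or] at h
  have h' : P {ω | ξ k ω = 1 ∨ ξ k ω = -1} = 1 := by
    rw [measureReal_def] at h
    rw [← ENNReal.toReal_eq_one_iff, h]
  exact (prob_compl_eq_zero_iff (hm1.union hm2)).2 h'

theorem IsStepSequence.identDistrib_step [IsProbabilityMeasure P] (hξ : IsStepSequence P p ξ)
    (j k : ℕ) : IdentDistrib (ξ j) (ξ k) P P where
  aemeasurable_fst := (hξ.measurable j).aemeasurable
  aemeasurable_snd := (hξ.measurable k).aemeasurable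
  map_eq := by
    refine Measure.ext_of_singleton fun z => ?_
    rw [Measure.map_apply (hξ.measurable j) (measurableSet_singleton z),
      Measure.map_apply (hξ.measurable k) (measurableSet_singleton z)]
    change P {ω | ξ j ω = z} = P {ω | ξ k ω = z}
    by_cases h1 : z = 1
    · subst h1
      rw [← ENNReal.toReal_eq_toReal_iff' (measure_ne_top _ _) (measure_ne_top _ _)]
      exact (hξ.prob_one j).trans (hξ.prob_one k).symm
    by_cases h2 : z = -1
    · subst h2
      rw [← ENNReal.toReal_eq_toReal_iff' (measure_ne_top _ _) (measure_ne_top _ _)]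
      exact (hξ.prob_neg_one j).trans (hξ.prob_neg_one k).symm
    have key : ∀ i, P {ω | ξ i ω = z} = 0 := by
      intro i
      refine measure_mono_null ?_ (ae_iff.1 hξ.ae_step)
      intro ω hω
      simp only [Set.mem_ofPred_eq] at hω ⊢
      intro h
      have := h i
      omega
    rw [key, key]

theorem IsStepSequence.measurable_path (hξ : IsStepSequence P p ξ) :
    Measurable (fun ω k => ξ k ω) :=
  measurable_pi_lambda _ hξ.measurable

theorem IsStepSequence.lintegral_shift [IsProbabilityMeasure P] (hξ : IsStepSequence P p ξ)
    (t : ℕ) {F : (ℕ → ℤ) → ℝ≥0∞} (hF : Measurable F) :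
    ∫⁻ ω, F (fun k => ξ (t + k) ω) ∂P = ∫⁻ ω, F (fun k => ξ k ω) ∂P := by
  have h := IdentDistrib.pi (fun k => hξ.identDistrib_step (t + k) k) (hξ.shift t).indep hξ.indep
  exact (h.comp hF).lintegral_eq

theorem IsStepSequence.measurable_firstSteps (hξ : IsStepSequence P p ξ) (t : ℕ) :
    Measurable (firstSteps ξ t) :=
  measurable_pi_lambda _ fun k => hξ.measurable k

theorem IsStepSequence.measurableSet_of_firstSteps (hξ : IsStepSequence P p ξ) {A : Set Ω} {t : ℕ}
    (hA : ∀ ω ω', (∀ k < t, ξ k ω = ξ k ω') → ω ∈ A → ω' ∈ A) : MeasurableSet A := by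
  obtain ⟨B, rfl⟩ := exists_firstSteps_preimage hA
  exact hξ.measurable_firstSteps t B.to_countable.measurableSet

theorem IsStepSequence.indepFun_firstSteps (hξ : IsStepSequence P p ξ) (t : ℕ) :
    IndepFun (firstSteps ξ t) (fun ω k => ξ (t + k) ω) P := by
  have h := indep_iSup_of_disjoint (fun k => (hξ.measurable k).comap_le) hξ.indep
    (S := {k | k < t}) (T := {k | t ≤ k})
    (Set.disjoint_left.2 fun k (h1 : k < t) (h2 : t ≤ k) => absurd h1 (not_lt.2 h2))
  rw [IndepFun_iff_Indep]
  refine indep_of_indep_of_le_left (indep_of_indep_of_le_right h ?_) ?_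
  · rw [MeasurableSpace.pi, MeasurableSpace.comap_iSup]
    refine iSup_le fun k => ?_
    rw [MeasurableSpace.comap_comp]
    exact le_iSup₂_of_le (f := fun k (_ : k ∈ {k | t ≤ k}) => MeasurableSpace.comap (ξ k) _)
      (t + k) (Nat.le_add_right t k) le_rfl
  · rw [MeasurableSpace.pi, MeasurableSpace.comap_iSup]
    refine iSup_le fun k => ?_
    rw [MeasurableSpace.comap_comp]
    exact le_iSup₂_of_le (f := fun k (_ : k ∈ {k | k < t}) => MeasurableSpace.comap (ξ k) _)
      (k : ℕ) k.2 le_rfl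

/-- The Markov property: what happens after time `t` is independent of an event settled by the
first `t` steps, and has the law of the whole path. -/
theorem IsStepSequence.setLIntegral_shift [IsProbabilityMeasure P] (hξ : IsStepSequence P p ξ)
    {A : Set Ω} {t : ℕ} (hA : ∀ ω ω', (∀ k < t, ξ k ω = ξ k ω') → ω ∈ A → ω' ∈ A)
    {F : (ℕ → ℤ) → ℝ≥0∞} (hF : Measurable F) :
    ∫⁻ ω in A, F (fun k => ξ (t + k) ω) ∂P = P A * ∫⁻ ω, F (fun k => ξ k ω) ∂P := by
  have hAm := hξ.measurableSet_of_firstSteps hA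
  obtain ⟨B, hB⟩ := exists_firstSteps_preimage hA
  have hBm : MeasurableSet B := B.to_countable.measurableSet
  have hind := (hξ.indepFun_firstSteps t).comp (φ := B.indicator (1 : (Fin t → ℤ) → ℝ≥0∞)) (ψ := F)
    (measurable_one.indicator hBm) hF
  have h := lintegral_mul_eq_lintegral_mul_lintegral_of_indepFun''
    ((measurable_one.indicator hBm).comp (hξ.measurable_firstSteps t)).aemeasurable
    (hF.comp (hξ.shift t).measurable_path).aemeasurable hind
  have hi : ∀ ω, B.indicator (1 : (Fin t → ℤ) → ℝ≥0∞) (firstSteps ξ t ω)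
      = A.indicator (1 : Ω → ℝ≥0∞) ω := by
    intro ω
    rw [hB]
    rfl
  simp only [Function.comp_apply, hi] at h
  rw [lintegral_indicator_one hAm, hξ.lintegral_shift t hF] at h
  rw [← h, ← lintegral_indicator hAm]
  refine lintegral_congr fun ω => ?_
  by_cases hω : ω ∈ A <;> simp [hω]

/-- First-step analysis: the expectation of `F` over the path, split by the first step. -/
theorem IsStepSequence.lintegral_first_step [IsProbabilityMeasure P] (hξ : IsStepSequence P p ξ)
    {F G H : (ℕ → ℤ) → ℝ≥0∞} (hG : Measurable G) (hH : Measurable H)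
    (hFG : ∀ x : ℕ → ℤ, x 0 = 1 → F x = G (fun k => x (1 + k)))
    (hFH : ∀ x : ℕ → ℤ, x 0 = -1 → F x = H (fun k => x (1 + k))) :
    ∫⁻ ω, F (fun k => ξ k ω) ∂P = ENNReal.ofReal p * ∫⁻ ω, G (fun k => ξ k ω) ∂P
      + ENNReal.ofReal (1 - p) * ∫⁻ ω, H (fun k => ξ k ω) ∂P := by
  have hp : ENNReal.ofReal p = P {ω | ξ 0 ω = 1} := by
    rw [← hξ.prob_one 0, ofReal_measureReal]
  have hq : ENNReal.ofReal (1 - p) = P {ω | ξ 0 ω = -1} := by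
    rw [← hξ.prob_neg_one 0, ofReal_measureReal]
  have hc : ∀ᵐ ω ∂P, ω ∈ {ω | ξ 0 ω = -1} ↔ ω ∈ {ω | ξ 0 ω = 1}ᶜ := by
    filter_upwards [hξ.ae_step] with ω hω
    have := hω 0
    simp only [Set.mem_ofPred_eq, Set.mem_compl_iff]
    omega
  have hm1 := hξ.measurableSet_step 0 1
  have hm2 := hξ.measurableSet_step 0 (-1)
  rw [hp, hq, ← hξ.setLIntegral_shift (t := 1) (A := {ω | ξ 0 ω = 1}) _ hG,
    ← hξ.setLIntegral_shift (t := 1) (A := {ω | ξ 0 ω = -1}) _ hH,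
    ← lintegral_add_compl _ hm1]
  · congr 1
    · exact setLIntegral_congr_fun hm1 fun ω hω => hFG _ hω
    · rw [← setLIntegral_congr (Filter.eventuallyEq_set.2 hc)]
      exact setLIntegral_congr_fun hm2 fun ω hω => hFH _ hω
  · intro ω ω' h hω
    exact (h 0 one_pos).symm.trans hω
  · intro ω ω' h hω
    exact (h 0 one_pos).symm.trans hω

end Markov

/-! ### The gambler's ruin problem -/

theorem netSteps_add {Ω : Type*} (ξ : ℕ → Ω → ℤ) (t n : ℕ) (ω : Ω) :
    netSteps ξ (t + n) ω = netSteps ξ t ω + netSteps (fun k => ξ (t + k)) n ω :=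
  Finset.sum_range_add _ _ _

@[simp]
theorem netSteps_zero {Ω : Type*} (ξ : ℕ → Ω → ℤ) (ω : Ω) : netSteps ξ 0 ω = 0 := rfl

@[simp]
theorem netSteps_one {Ω : Type*} (ξ : ℕ → Ω → ℤ) (ω : Ω) : netSteps ξ 1 ω = ξ 0 ω :=
  Finset.sum_range_one _

theorem netSteps_succ {Ω : Type*} (ξ : ℕ → Ω → ℤ) (n : ℕ) (ω : Ω) :
    netSteps ξ (n + 1) ω = netSteps ξ n ω + ξ n ω :=
  Finset.sum_range_succ _ _

theorem netSteps_congr {Ω : Type*} {ξ : ℕ → Ω → ℤ} {n : ℕ} {ω ω' : Ω}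
    (h : ∀ k < n, ξ k ω = ξ k ω') : netSteps ξ n ω = netSteps ξ n ω' :=
  Finset.sum_congr rfl fun k hk => h k (Finset.mem_range.1 hk)

/-- The coordinate process on the space of integer sequences. A functional of the path of a process
`ξ` is the same functional of `coords`, evaluated at the sequence `fun k => ξ k ω`. -/
def coords : ℕ → (ℕ → ℤ) → ℤ := fun k x => x k

theorem measurable_netSteps_coords (n : ℕ) : Measurable (netSteps coords n) :=
  Finset.measurable_fun_sum _ fun k _ => measurable_pi_apply k

/-- The event that a gambler who starts with `i` dollars reaches `N` dollars before being ruined. -/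
def ruinWin (i N : ℕ) {Ω : Type*} (ξ : ℕ → Ω → ℤ) : Set Ω :=
  {ω | ∃ n, (i : ℤ) + netSteps ξ n ω = N ∧ ∀ k ≤ n, (i : ℤ) + netSteps ξ k ω ≠ 0}

theorem ruinDuration_le {i N : ℕ} {Ω : Type*} {ξ : ℕ → Ω → ℤ} {ω : Ω} {n : ℕ}
    (h : (i : ℤ) + netSteps ξ n ω = 0 ∨ (i : ℤ) + netSteps ξ n ω = N) :
    ruinDuration i N ξ ω ≤ n :=
  iInf₂_le n h

theorem ruinDuration_zero (N : ℕ) {Ω : Type*} (ξ : ℕ → Ω → ℤ) (ω : Ω) :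
    ruinDuration 0 N ξ ω = 0 :=
  nonpos_iff_eq_zero.1 (ruinDuration_le (n := 0) (by simp))

theorem ruinDuration_self (N : ℕ) {Ω : Type*} (ξ : ℕ → Ω → ℤ) (ω : Ω) :
    ruinDuration N N ξ ω = 0 :=
  nonpos_iff_eq_zero.1 (ruinDuration_le (n := 0) (by simp))

/-- A gambler with a fortune strictly between `0` and `N` places a bet and starts afresh. -/
theorem ruinDuration_first_step {i j N : ℕ} {Ω : Type*} {ξ : ℕ → Ω → ℤ} {ω : Ω} (hi : i ≠ 0)
    (hiN : i ≠ N) (hj : (j : ℤ) = i + ξ 0 ω) :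
    ruinDuration i N ξ ω = 1 + ruinDuration j N (fun k => ξ (1 + k)) ω := by
  have key : ∀ n, (i : ℤ) + netSteps ξ (1 + n) ω = j + netSteps (fun k => ξ (1 + k)) n ω := by
    intro n
    rw [netSteps_add, netSteps_one, hj]
    ring
  unfold ruinDuration
  rw [ENat.add_iInf₂]
  apply le_antisymm
  · refine le_iInf₂ fun n hn => ?_
    rw [← key] at hn
    refine (iInf₂_le (1 + n) hn).trans ?_
    push_cast
    exact le_rfl
  · refine le_iInf₂ fun n hn => ?_
    rcases n with _ | n
    · simp only [netSteps_zero] at hn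
      omega
    · rw [add_comm n 1, key] at hn
      refine (iInf₂_le n hn).trans ?_
      push_cast
      rw [add_comm]

theorem measurable_ruinDuration_coords (i N : ℕ) :
    Measurable (fun x => (ruinDuration i N coords x : ℝ≥0∞)) := by
  simp only [ruinDuration, ENat.toENNReal_iInf]
  refine Measurable.iInf fun n => ?_
  have h1 : MeasurableSet {x | (i : ℤ) + netSteps coords n x = 0 ∨
      (i : ℤ) + netSteps coords n x = N} :=
    (measurable_netSteps_coords n) (Set.to_countable
      {z : ℤ | (i : ℤ) + z = 0 ∨ (i : ℤ) + z = N}).measurableSet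
  classical
  have h2 : (fun x : ℕ → ℤ => ⨅ (_ : (i : ℤ) + netSteps coords n x = 0 ∨
      (i : ℤ) + netSteps coords n x = N), (((n : ℕ∞) : ℝ≥0∞))) =
      fun x => if (i : ℤ) + netSteps coords n x = 0 ∨ (i : ℤ) + netSteps coords n x = N
        then ((n : ℕ∞) : ℝ≥0∞) else ⊤ := by
    funext x
    split_ifs with h <;> simp [h]
  rw [h2]
  exact Measurable.ite h1 measurable_const measurable_const

theorem ruinWin_zero (N : ℕ) {Ω : Type*} (ξ : ℕ → Ω → ℤ) : ruinWin 0 N ξ = ∅ := by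
  ext ω
  simp only [ruinWin, Set.mem_ofPred_eq, Set.mem_empty_iff_false, iff_false]
  rintro ⟨n, -, h⟩
  exact h 0 n.zero_le (by simp)

theorem ruinWin_self {N : ℕ} (hN : N ≠ 0) {Ω : Type*} (ξ : ℕ → Ω → ℤ) :
    ruinWin N N ξ = Set.univ := by
  ext ω
  simp only [ruinWin, Set.mem_ofPred_eq, Set.mem_univ, iff_true]
  refine ⟨0, by simp, fun k hk => ?_⟩
  obtain rfl : k = 0 := by omega
  simpa using hN

theorem mem_ruinWin_first_step {i j N : ℕ} {Ω : Type*} {ξ : ℕ → Ω → ℤ} {ω : Ω} (hi : i ≠ 0)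
    (hiN : i ≠ N) (hj : (j : ℤ) = i + ξ 0 ω) :
    ω ∈ ruinWin i N ξ ↔ ω ∈ ruinWin j N (fun k => ξ (1 + k)) := by
  have key : ∀ n, (i : ℤ) + netSteps ξ (1 + n) ω = j + netSteps (fun k => ξ (1 + k)) n ω := by
    intro n
    rw [netSteps_add, netSteps_one, hj]
    ring
  simp only [ruinWin, Set.mem_ofPred_eq]
  constructor
  · rintro ⟨n, hn, h⟩
    rcases n with _ | n
    · simp only [netSteps_zero] at hn
      omega
    · refine ⟨n, ?_, fun k hk => ?_⟩
      · rw [← key, add_comm 1 n, hn]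
      · rw [← key]
        exact h _ (by omega)
  · rintro ⟨n, hn, h⟩
    refine ⟨1 + n, by rw [key, hn], fun k hk => ?_⟩
    rcases k with _ | k
    · simpa using hi
    · rw [add_comm k 1, key]
      exact h _ (by omega)

theorem measurableSet_ruinWin_coords (i N : ℕ) : MeasurableSet (ruinWin i N coords) := by
  have h : ruinWin i N coords = ⋃ n, ({x | (i : ℤ) + netSteps coords n x = N} ∩
      ⋂ k, ⋂ (_ : k ≤ n), {x | (i : ℤ) + netSteps coords k x ≠ 0}) := by
    ext x
    simp [ruinWin]
  rw [h]
  refine MeasurableSet.iUnion fun n => MeasurableSet.inter ?_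
    (MeasurableSet.iInter fun k => MeasurableSet.iInter fun _ => ?_)
  · exact (measurable_netSteps_coords n) (Set.to_countable {z : ℤ | (i : ℤ) + z = N}).measurableSet
  · exact (measurable_netSteps_coords k) (Set.to_countable {z : ℤ | (i : ℤ) + z ≠ 0}).measurableSet

section Gambler

variable {Ω : Type*} [MeasurableSpace Ω] {P : Measure Ω} {p : ℝ} {ξ : ℕ → Ω → ℤ}

theorem IsStepSequence.measurableSet_ruinWin (hξ : IsStepSequence P p ξ) (i N : ℕ) :
    MeasurableSet (ruinWin i N ξ) :=
  hξ.measurable_path (measurableSet_ruinWin_coords i N)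

theorem IsStepSequence.lintegral_ruinDuration_min_succ [IsProbabilityMeasure P]
    (hξ : IsStepSequence P p ξ) {i N : ℕ} (hiN : i + 1 < N) (c : ℝ≥0∞) :
    ∫⁻ ω, min (ruinDuration (i + 1) N ξ ω : ℝ≥0∞) (1 + c) ∂P =
      ENNReal.ofReal p * (1 + ∫⁻ ω, min (ruinDuration (i + 2) N ξ ω : ℝ≥0∞) c ∂P) +
      ENNReal.ofReal (1 - p) * (1 + ∫⁻ ω, min (ruinDuration i N ξ ω : ℝ≥0∞) c ∂P) := by
  have hm : ∀ i, Measurable fun x => min (ruinDuration i N coords x : ℝ≥0∞) c := fun i =>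
    (measurable_ruinDuration_coords i N).min measurable_const
  have h := hξ.lintegral_first_step
    (F := fun x => min (ruinDuration (i + 1) N coords x : ℝ≥0∞) (1 + c))
    (G := fun x => 1 + min (ruinDuration (i + 2) N coords x : ℝ≥0∞) c)
    (H := fun x => 1 + min (ruinDuration i N coords x : ℝ≥0∞) c)
    ((hm _).const_add 1) ((hm _).const_add 1) ?_ ?_
  · rw [lintegral_add_left measurable_const, lintegral_add_left measurable_const,
      lintegral_one, measure_univ] at h
    exact h
  · intro x hx
    have := ruinDuration_first_step (N := N) (ξ := coords) (ω := x) (i := i + 1) (j := i + 2)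
      (by omega) (by omega) (by simp only [coords, hx]; push_cast; ring)
    rw [this, ENat.toENNReal_add, ENat.toENNReal_one, min_add_add_left]
    rfl
  · intro x hx
    have := ruinDuration_first_step (N := N) (ξ := coords) (ω := x) (i := i + 1) (j := i)
      (by omega) (by omega) (by simp only [coords, hx]; push_cast; ring)
    rw [this, ENat.toENNReal_add, ENat.toENNReal_one, min_add_add_left]
    rfl

theorem IsStepSequence.expectedSteps_ruinDuration_succ [IsProbabilityMeasure P]
    (hξ : IsStepSequence P p ξ) {i N : ℕ} (hiN : i + 1 < N) :
    expectedSteps P (ruinDuration (i + 1) N ξ) =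
      ENNReal.ofReal p * (1 + expectedSteps P (ruinDuration (i + 2) N ξ)) +
      ENNReal.ofReal (1 - p) * (1 + expectedSteps P (ruinDuration i N ξ)) := by
  simpa [expectedSteps] using hξ.lintegral_ruinDuration_min_succ hiN ⊤

theorem expectedSteps_ruinDuration_zero (N : ℕ) :
    expectedSteps P (ruinDuration 0 N ξ) = 0 := by
  simp [expectedSteps, ruinDuration_zero]

theorem expectedSteps_ruinDuration_self (N : ℕ) :
    expectedSteps P (ruinDuration N N ξ) = 0 := by
  simp [expectedSteps, ruinDuration_self]

/-- With `q = 1 - p`, the function `f i = (p⁻¹ ^ N - p⁻¹ ^ i) / q` is nonnegative up to `N` and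
satisfies `1 + p * f (i + 1) + q * f (i - 1) ≤ f i`, so it dominates the expected number of bets
that are placed before any fixed time. -/
theorem IsStepSequence.lintegral_ruinDuration_min_le [IsProbabilityMeasure P]
    (hξ : IsStepSequence P p ξ) (hp0 : 0 < p) (hp1 : p < 1) (N n : ℕ) {i : ℕ} (hi : i ≤ N) :
    ∫⁻ ω, min (ruinDuration i N ξ ω : ℝ≥0∞) n ∂P
      ≤ ENNReal.ofReal ((p⁻¹ ^ N - p⁻¹ ^ i) / (1 - p)) := by
  have hq : 0 < 1 - p := by linarith
  have hl : 1 ≤ p⁻¹ := (one_le_inv₀ hp0).2 hp1.le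
  have hnn : ∀ i ≤ N, 0 ≤ (p⁻¹ ^ N - p⁻¹ ^ i) / (1 - p) := fun i hi =>
    div_nonneg (sub_nonneg.2 (pow_le_pow_right₀ hl hi)) hq.le
  induction n generalizing i with
  | zero => simp
  | succ n ih =>
    rcases i with _ | i
    · simp [ruinDuration_zero]
    rcases hi.eq_or_lt with rfl | hlt
    · simp [ruinDuration_self]
    rw [Nat.cast_succ, add_comm (n : ℝ≥0∞) 1, hξ.lintegral_ruinDuration_min_succ hlt]
    have h1 := hnn (i + 2) hlt
    have h2 := hnn i (by omega)
    calc _ ≤ ENNReal.ofReal p * (1 + ENNReal.ofReal ((p⁻¹ ^ N - p⁻¹ ^ (i + 2)) / (1 - p))) +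
          ENNReal.ofReal (1 - p) * (1 + ENNReal.ofReal ((p⁻¹ ^ N - p⁻¹ ^ i) / (1 - p))) := by
          gcongr
          · exact ih hlt
          · exact ih (by omega)
      _ = ENNReal.ofReal (p * (1 + (p⁻¹ ^ N - p⁻¹ ^ (i + 2)) / (1 - p)) +
          (1 - p) * (1 + (p⁻¹ ^ N - p⁻¹ ^ i) / (1 - p))) := by
          rw [← ENNReal.ofReal_one, ← ENNReal.ofReal_add zero_le_one h1,
            ← ENNReal.ofReal_add zero_le_one h2, ← ENNReal.ofReal_mul hp0.le,
            ← ENNReal.ofReal_mul hq.le, ← ENNReal.ofReal_add (by positivity) (by positivity)]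
      _ ≤ _ := by
          apply ENNReal.ofReal_le_ofReal
          have hpi : 1 ≤ p⁻¹ ^ i := one_le_pow₀ hl
          have e : (p⁻¹ ^ N - p⁻¹ ^ (i + 1)) / (1 - p) -
              (p * (1 + (p⁻¹ ^ N - p⁻¹ ^ (i + 2)) / (1 - p)) +
              (1 - p) * (1 + (p⁻¹ ^ N - p⁻¹ ^ i) / (1 - p))) = p⁻¹ ^ i - 1 := by
            have hp := hp0.ne'
            have hq' := hq.ne'
            rw [pow_add p⁻¹ i 2, pow_succ p⁻¹ i]
            generalize p⁻¹ ^ N = a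
            generalize p⁻¹ ^ i = b
            field_simp
            ring
          linarith

theorem IsStepSequence.expectedSteps_ruinDuration_ne_top [IsProbabilityMeasure P]
    (hξ : IsStepSequence P p ξ) (hp0 : 0 < p) (hp1 : p < 1) {i N : ℕ} (hi : i ≤ N) :
    expectedSteps P (ruinDuration i N ξ) ≠ ∞ := by
  have hmeas : Measurable fun ω => (ruinDuration i N ξ ω : ℝ≥0∞) :=
    (measurable_ruinDuration_coords i N).comp hξ.measurable_path
  have hsup : ∀ x : ℝ≥0∞, ⨆ n : ℕ, min x n = x := by
    intro x
    rw [← inf_iSup_eq (f := fun n : ℕ => (n : ℝ≥0∞)), ENNReal.iSup_natCast, inf_top_eq]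
  have h : expectedSteps P (ruinDuration i N ξ)
      = ⨆ n : ℕ, ∫⁻ ω, min (ruinDuration i N ξ ω : ℝ≥0∞) n ∂P := by
    rw [← lintegral_iSup (fun n => hmeas.min measurable_const)]
    · simp only [hsup, expectedSteps]
    · intro a b hab ω
      exact min_le_min_left _ (by exact_mod_cast hab)
  rw [h]
  exact ne_top_of_le_ne_top ENNReal.ofReal_ne_top
    (iSup_le fun n => hξ.lintegral_ruinDuration_min_le hp0 hp1 N n hi)

theorem IsStepSequence.toReal_expectedSteps_ruinDuration_succ [IsProbabilityMeasure P]
    (hξ : IsStepSequence P p ξ) (hp0 : 0 < p) (hp1 : p < 1) {i N : ℕ} (hiN : i + 1 < N) :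
    (expectedSteps P (ruinDuration (i + 1) N ξ)).toReal =
      1 + p * (expectedSteps P (ruinDuration (i + 2) N ξ)).toReal +
      (1 - p) * (expectedSteps P (ruinDuration i N ξ)).toReal := by
  have h1 := hξ.expectedSteps_ruinDuration_ne_top hp0 hp1 (i := i) (N := N) (by omega)
  have h2 := hξ.expectedSteps_ruinDuration_ne_top hp0 hp1 (i := i + 2) (N := N) (by omega)
  rw [hξ.expectedSteps_ruinDuration_succ hiN, ENNReal.toReal_add (by finiteness) (by finiteness),
    ENNReal.toReal_mul, ENNReal.toReal_mul, ENNReal.toReal_add (by finiteness) h1,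
    ENNReal.toReal_add (by finiteness) h2, ENNReal.toReal_ofReal hp0.le,
    ENNReal.toReal_ofReal (by linarith), ENNReal.toReal_one]
  ring

theorem IsStepSequence.real_ruinWin_succ [IsProbabilityMeasure P]
    (hξ : IsStepSequence P p ξ) (hp0 : 0 < p) (hp1 : p < 1) {i N : ℕ} (hiN : i + 1 < N) :
    P.real (ruinWin (i + 1) N ξ) =
      p * P.real (ruinWin (i + 2) N ξ) + (1 - p) * P.real (ruinWin i N ξ) := by
  have hI : ∀ i, ∫⁻ ω, (ruinWin i N coords).indicator (1 : (ℕ → ℤ) → ℝ≥0∞) (fun k => ξ k ω) ∂P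
      = P (ruinWin i N ξ) := by
    intro i
    rw [← lintegral_indicator_one (hξ.measurableSet_ruinWin i N)]
    rfl
  have hm : ∀ i, Measurable ((ruinWin i N coords).indicator (1 : (ℕ → ℤ) → ℝ≥0∞)) := fun i =>
    measurable_one.indicator (measurableSet_ruinWin_coords i N)
  have h := hξ.lintegral_first_step (F := (ruinWin (i + 1) N coords).indicator 1)
    (hm (i + 2)) (hm i) ?_ ?_
  · rw [hI, hI, hI] at h
    rw [measureReal_def, h, ENNReal.toReal_add (by finiteness) (by finiteness),
      ENNReal.toReal_mul, ENNReal.toReal_mul, ENNReal.toReal_ofReal hp0.le,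
      ENNReal.toReal_ofReal (by linarith)]
    rfl
  · intro x hx
    have := mem_ruinWin_first_step (N := N) (ξ := coords) (ω := x) (i := i + 1) (j := i + 2)
      (by omega) (by omega) (by simp only [coords, hx]; push_cast; ring)
    classical
    rw [Set.indicator_apply, Set.indicator_apply]
    exact if_congr this rfl rfl
  · intro x hx
    have := mem_ruinWin_first_step (N := N) (ξ := coords) (ω := x) (i := i + 1) (j := i)
      (by omega) (by omega) (by simp only [coords, hx]; push_cast; ring)
    classical
    rw [Set.indicator_apply, Set.indicator_apply]
    exact if_congr this rfl rfl

/-- The solutions of `h (i + 1) = p * h (i + 2) + (1 - p) * h i` that vanish at `0` are the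
multiples of the geometric sums with ratio `(1 - p) / p`. -/
theorem eq_mul_geom_sum_of_harmonic {p r : ℝ} (hp0 : 0 < p) (hr : r = (1 - p) / p) {N : ℕ}
    {h : ℕ → ℝ} (h0 : h 0 = 0)
    (hh : ∀ i, i + 1 < N → h (i + 1) = p * h (i + 2) + (1 - p) * h i) {i : ℕ} (hi : i ≤ N) :
    h i = h 1 * ∑ j ∈ Finset.range i, r ^ j := by
  induction i using Nat.twoStepInduction with
  | zero => simpa using h0
  | one => simp
  | more i ih1 ih2 =>
    have e := hh i hi
    rw [ih2 (by omega), ih1 (by omega), Finset.sum_range_succ] at e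
    rw [Finset.sum_range_succ, Finset.sum_range_succ, pow_succ]
    have hq : 1 - p = r * p := by rw [hr]; field_simp
    rw [hq] at e
    have hp : p = 1 - r * p := by linarith
    apply mul_left_cancel₀ hp0.ne'
    linear_combination -e - (h 1 * ∑ j ∈ Finset.range i, r ^ j + h 1 * r ^ i) * hp

theorem geom_sum_pos_of_pos {r : ℝ} (hr : 0 < r) {N : ℕ} (hN : N ≠ 0) :
    0 < ∑ j ∈ Finset.range N, r ^ j :=
  Finset.sum_pos (fun j _ => pow_pos hr j) (Finset.nonempty_range_iff.2 hN)

theorem IsStepSequence.real_ruinWin [IsProbabilityMeasure P] (hξ : IsStepSequence P p ξ)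
    (hp0 : 0 < p) (hp1 : p < 1) {r : ℝ} (hr : r = (1 - p) / p) {i N : ℕ} (hN : N ≠ 0)
    (hi : i ≤ N) :
    P.real (ruinWin i N ξ)
      = (∑ j ∈ Finset.range i, r ^ j) / ∑ j ∈ Finset.range N, r ^ j := by
  have hr0 : 0 < r := by rw [hr]; exact div_pos (by linarith) hp0
  have key : ∀ i ≤ N, _ := fun i hi =>
    eq_mul_geom_sum_of_harmonic (h := fun i => P.real (ruinWin i N ξ)) hp0 hr
      (by simp [ruinWin_zero]) (fun i h => hξ.real_ruinWin_succ hp0 hp1 h) hi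
  have h1 := key N le_rfl
  have h2 := key i hi
  simp only [ruinWin_self hN, probReal_univ] at h1 h2
  have hs := geom_sum_pos_of_pos hr0 hN
  rw [h2, eq_div_iff hs.ne']
  linear_combination (-∑ j ∈ Finset.range i, r ^ j) * h1

/-- The expected number of bets is the only solution of its first-step equation with value `0` at
the two ends. -/
theorem IsStepSequence.toReal_expectedSteps_ruinDuration_eq [IsProbabilityMeasure P]
    (hξ : IsStepSequence P p ξ) (hp0 : 0 < p) (hp1 : p < 1) {N : ℕ} {g : ℕ → ℝ} (g0 : g 0 = 0)
    (gN : g N = 0) (hg : ∀ i, g (i + 1) = 1 + p * g (i + 2) + (1 - p) * g i) {i : ℕ}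
    (hi : i ≤ N) :
    (expectedSteps P (ruinDuration i N ξ)).toReal = g i := by
  rcases Nat.eq_zero_or_pos N with rfl | hN
  · obtain rfl : i = 0 := by omega
    simp [expectedSteps_ruinDuration_zero, g0]
  have hr0 : 0 < (1 - p) / p := div_pos (by linarith) hp0
  have key : ∀ i ≤ N, _ := fun i hi =>
    eq_mul_geom_sum_of_harmonic
      (h := fun i => (expectedSteps P (ruinDuration i N ξ)).toReal - g i) hp0 rfl
      (by simp [expectedSteps_ruinDuration_zero, g0])
      (fun i h => by
        have h1 := hξ.toReal_expectedSteps_ruinDuration_succ hp0 hp1 h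
        linear_combination h1 - hg i) hi
  have h1 := key N le_rfl
  have h2 := key i hi
  simp only [expectedSteps_ruinDuration_self, gN, ENNReal.toReal_zero, sub_zero] at h1
  have h3 := (mul_eq_zero.1 h1.symm).resolve_right (geom_sum_pos_of_pos hr0 hN.ne').ne'
  rw [h3, zero_mul] at h2
  exact sub_eq_zero.1 h2

theorem IsStepSequence.toReal_expectedSteps_ruinDuration_symm [IsProbabilityMeasure P]
    (hξ : IsStepSequence P p ξ) (hp : p = 1 / 2) {i N : ℕ} (hi : i ≤ N) :
    (expectedSteps P (ruinDuration i N ξ)).toReal = i * (N - i) := by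
  refine hξ.toReal_expectedSteps_ruinDuration_eq (g := fun i => i * (N - i)) (by norm_num [hp])
    (by norm_num [hp]) (by simp) (by simp) (fun i => ?_) hi
  rw [hp]
  push_cast
  ring

theorem IsStepSequence.toReal_expectedSteps_ruinDuration_asymm [IsProbabilityMeasure P]
    (hξ : IsStepSequence P p ξ) (hp0 : 0 < p) (hp1 : p < 1) {r : ℝ} (hr : r = (1 - p) / p)
    (hr1 : r ≠ 1) {i N : ℕ} (hN : N ≠ 0) (hi : i ≤ N) :
    (expectedSteps P (ruinDuration i N ξ)).toReal
      = (r + 1) / (r - 1) * (i - N * (r ^ i - 1) / (r ^ N - 1)) := by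
  have hr0 : 0 < r := by rw [hr]; exact div_pos (by linarith) hp0
  have hN1 : r ^ N - 1 ≠ 0 := sub_ne_zero.2 fun h => hr1 ((pow_eq_one_iff_of_nonneg hr0.le hN).1 h)
  have hr1' : r - 1 ≠ 0 := sub_ne_zero.2 hr1
  refine hξ.toReal_expectedSteps_ruinDuration_eq
    (g := fun i => (r + 1) / (r - 1) * (i - N * (r ^ i - 1) / (r ^ N - 1))) hp0 hp1
    (by simp) (by field_simp; simp) (fun i => ?_) hi
  have hp : p = 1 / (r + 1) := by
    rw [hr]
    field_simp
    ring
  have hr2 : r + 1 ≠ 0 := by positivity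
  rw [hp, pow_add r i 2, pow_succ r i]
  push_cast
  generalize r ^ N - 1 = a at hN1
  generalize r ^ i = b
  field_simp
  ring

end Gambler

/-! ### The cover time of the polygon -/

section Paths

variable {Ω : Type*} {ξ : ℕ → Ω → ℤ} {ω : Ω} {m : ℕ}

/-- A path with steps `±1` takes every value between `0` and its value at time `n` by time `n`. -/
theorem exists_netSteps_eq (hs : ∀ k, ξ k ω = 1 ∨ ξ k ω = -1) {n : ℕ} {z : ℤ}
    (h : 0 ≤ z ∧ z ≤ netSteps ξ n ω ∨ netSteps ξ n ω ≤ z ∧ z ≤ 0) :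
    ∃ k ≤ n, netSteps ξ k ω = z := by
  induction n with
  | zero =>
    rw [netSteps_zero] at h
    exact ⟨0, le_rfl, by rw [netSteps_zero]; omega⟩
  | succ n ih =>
    by_cases hz : netSteps ξ (n + 1) ω = z
    · exact ⟨n + 1, le_rfl, hz⟩
    · have h1 := hs n
      rw [netSteps_succ] at h hz
      obtain ⟨k, hk, hkz⟩ := ih (by omega)
      exact ⟨k, hk.trans n.le_succ, hkz⟩

theorem ruinWin_mono (hs : ∀ k, ξ k ω = 1 ∨ ξ k ω = -1) {i N : ℕ} (hi : i + 1 ≤ N)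
    (h : ω ∈ ruinWin i N ξ) : ω ∈ ruinWin (i + 1) N ξ := by
  obtain ⟨n, hn, hn0⟩ := h
  obtain ⟨k, hk, hkz⟩ := exists_netSteps_eq hs (n := n) (z := N - i - 1) (by omega)
  refine ⟨k, by push_cast; omega, fun l hl h => ?_⟩
  obtain ⟨j, hj, hjz⟩ := exists_netSteps_eq hs (n := l) (z := -i) (by push_cast at h; omega)
  exact hn0 j (by omega) (by omega)

theorem position_eq_intCast_iff {n : ℕ} {z : ℤ} :
    position m ξ n ω = z ↔ ((m : ℤ) + 1) ∣ z - netSteps ξ n ω := by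
  rw [position, ZMod.intCast_eq_intCast_iff_dvd_sub]
  push_cast
  rfl

theorem position_zero : position m ξ 0 ω = 0 := by simp [position]

/-- All vertices have been visited by time `n`. -/
def Covers (m : ℕ) {Ω : Type*} (ξ : ℕ → Ω → ℤ) (ω : Ω) (n : ℕ) : Prop :=
  ∀ v : ZMod (m + 1), ∃ k ≤ n, position m ξ k ω = v

theorem isCoverTime_iff {t : ℕ} :
    IsCoverTime m ξ ω t ↔ Covers m ξ ω t ∧ ∀ n < t, ¬ Covers m ξ ω n := by
  refine and_congr Iff.rfl ?_
  simp only [mem_lowerBounds]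
  exact ⟨fun h n hn hc => absurd (h n hc) (not_le.2 hn),
    fun h n hc => not_lt.1 fun hn => h n hn hc⟩

theorem Covers.exists_isCoverTime {n : ℕ} (h : Covers m ξ ω n) : ∃ t, IsCoverTime m ξ ω t := by
  classical
  have hex : ∃ n, Covers m ξ ω n := ⟨n, h⟩
  exact ⟨Nat.find hex, isCoverTime_iff.2 ⟨Nat.find_spec hex, fun _ hn => Nat.find_min hex hn⟩⟩

/-- The vertex occupied at the cover time has not been visited before. -/
theorem IsCoverTime.position_ne {t k : ℕ} (ht : IsCoverTime m ξ ω t) (hk : k < t) :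
    position m ξ k ω ≠ position m ξ t ω := by
  intro he
  obtain ⟨s, rfl⟩ := Nat.exists_eq_succ_of_ne_zero (Nat.ne_zero_of_lt hk)
  refine (isCoverTime_iff.1 ht).2 s s.lt_succ_self fun v => ?_
  obtain ⟨j, hj, rfl⟩ := ht.1 v
  rcases hj.eq_or_lt with rfl | hlt
  · exact ⟨k, Nat.lt_succ_iff.1 hk, he⟩
  · exact ⟨j, Nat.lt_succ_iff.1 hlt, rfl⟩

theorem IsCoverTime.unique {s t : ℕ} (hs : IsCoverTime m ξ ω s) (ht : IsCoverTime m ξ ω t) :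
    s = t :=
  IsLeast.unique hs ht

theorem IsCoverTime.position_ne_zero (hm : 1 ≤ m) {t : ℕ} (ht : IsCoverTime m ξ ω t) :
    position m ξ t ω ≠ 0 := by
  have : Fact (1 < m + 1) := ⟨by omega⟩
  have h0 : 0 < t := by
    rw [Nat.pos_iff_ne_zero]
    rintro rfl
    obtain ⟨k, hk, h1⟩ := ht.1 1
    obtain rfl : k = 0 := by omega
    rw [position_zero] at h1
    exact zero_ne_one h1
  rw [← position_zero (ξ := ξ) (ω := ω)]
  exact (ht.position_ne h0).symm

theorem exists_natCast_eq_of_ne_zero {v : ZMod (m + 1)} (hv : v ≠ 0) :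
    ∃ i ∈ Finset.Icc 1 m, v = (i : ZMod (m + 1)) := by
  refine ⟨v.val, ?_, (ZMod.natCast_zmod_val v).symm⟩
  have h1 := ZMod.val_lt v
  have h2 : v.val ≠ 0 := fun h => hv ((ZMod.val_eq_zero v).1 h)
  rw [Finset.mem_Icc]
  omega

theorem natCast_injOn_Icc :
    Set.InjOn (fun i : ℕ => (i : ZMod (m + 1))) (Finset.Icc 1 m : Finset ℕ) := by
  intro i hi j hj h
  rw [Finset.mem_coe, Finset.mem_Icc] at hi hj
  have := congrArg ZMod.val h
  simp only at this
  rwa [ZMod.val_natCast_of_lt (by omega), ZMod.val_natCast_of_lt (by omega)] at this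

/-- Before the cover time, a path whose last new vertex is `i` stays between the two lifts
`i - (m + 1)` and `i` of that vertex. -/
theorem IsCoverTime.netSteps_bounds (hs : ∀ k, ξ k ω = 1 ∨ ξ k ω = -1) {t i k : ℕ}
    (ht : IsCoverTime m ξ ω t) (hi : i ∈ Finset.Icc 1 m)
    (hti : position m ξ t ω = (i : ZMod (m + 1))) (hk : k < t) :
    (i : ℤ) - m ≤ netSteps ξ k ω ∧ netSteps ξ k ω ≤ i - 1 := by
  rw [Finset.mem_Icc] at hi
  by_contra hcon
  obtain ⟨z, hz, hdvd⟩ : ∃ z, (0 ≤ z ∧ z ≤ netSteps ξ k ω ∨ netSteps ξ k ω ≤ z ∧ z ≤ 0) ∧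
      ((m : ℤ) + 1) ∣ i - z := by
    by_cases h : netSteps ξ k ω ≤ i - 1
    · exact ⟨i - m - 1, by omega, ⟨1, by ring⟩⟩
    · exact ⟨i, by omega, ⟨0, by ring⟩⟩
  obtain ⟨j, hj, hjz⟩ := exists_netSteps_eq hs hz
  refine ht.position_ne (k := j) (by omega) ?_
  rw [hti, ← Int.cast_natCast (R := ZMod (m + 1)), position_eq_intCast_iff, hjz]
  exact hdvd

/-- Every integer strictly between the lifts `i - (m + 1)` and `i` of the last vertex is visited
before the cover time, because it is the only lift of its vertex in that range. -/
theorem IsCoverTime.exists_netSteps_eq (hs : ∀ k, ξ k ω = 1 ∨ ξ k ω = -1) {t i : ℕ}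
    (ht : IsCoverTime m ξ ω t) (hi : i ∈ Finset.Icc 1 m)
    (hti : position m ξ t ω = (i : ZMod (m + 1))) {z : ℤ} (hz1 : (i : ℤ) - m ≤ z)
    (hz2 : z ≤ i - 1) : ∃ k < t, netSteps ξ k ω = z := by
  obtain ⟨k, hk, hkz⟩ := ht.1 (z : ZMod (m + 1))
  have hkt : k ≠ t := by
    rintro rfl
    rw [hti, ← Int.cast_natCast (R := ZMod (m + 1)), ZMod.intCast_eq_intCast_iff_dvd_sub] at hkz
    push_cast at hkz
    have := Int.eq_zero_of_abs_lt_dvd hkz (by rw [abs_lt]; omega)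
    omega
  have hlt : k < t := by omega
  have hb := ht.netSteps_bounds hs hi hti hlt
  rw [position_eq_intCast_iff] at hkz
  have := Int.eq_zero_of_abs_lt_dvd hkz (by rw [abs_lt]; omega)
  exact ⟨k, hlt, by omega⟩

/-- If `i` is the last vertex to be visited, then the path reaches `i - 1` before `i - (m + 1)`, but
does not reach `i` before `i - m`. Both are events of a ruin problem with goal `m`. -/
theorem IsCoverTime.mem_ruinWin_diff (hs : ∀ k, ξ k ω = 1 ∨ ξ k ω = -1) {t i : ℕ}
    (ht : IsCoverTime m ξ ω t) (hi : i ∈ Finset.Icc 1 m)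
    (hti : position m ξ t ω = (i : ZMod (m + 1))) :
    ω ∈ ruinWin (m + 1 - i) m ξ \ ruinWin (m - i) m ξ := by
  have hi' := Finset.mem_Icc.1 hi
  constructor
  · obtain ⟨k, hk, hkz⟩ := ht.exists_netSteps_eq hs hi hti (z := i - 1) (by omega) le_rfl
    refine ⟨k, by omega, fun l hl => ?_⟩
    have := ht.netSteps_bounds hs hi hti (hl.trans_lt hk)
    omega
  · rintro ⟨n, hn, hn0⟩
    obtain ⟨k, hk, hkz⟩ := ht.exists_netSteps_eq hs hi hti (z := i - m) le_rfl (by omega)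
    have hkn : n < k := by
      by_contra h
      exact hn0 k (by omega) (by omega)
    have := ht.netSteps_bounds hs hi hti (hkn.trans hk)
    omega

theorem exists_isCoverTime_of_ruinDuration_ne_top (hs : ∀ k, ξ k ω = 1 ∨ ξ k ω = -1)
    (h : ruinDuration (m + 1) (2 * (m + 1)) ξ ω ≠ ⊤) : ∃ t, IsCoverTime m ξ ω t := by
  obtain ⟨n, hn⟩ : ∃ n, ((m + 1 : ℕ) : ℤ) + netSteps ξ n ω = 0 ∨
      ((m + 1 : ℕ) : ℤ) + netSteps ξ n ω = (2 * (m + 1) : ℕ) := by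
    by_contra hcon
    push Not at hcon
    refine h (iInf₂_eq_top.2 fun n hn => ?_)
    have := hcon n
    omega
  push_cast at hn
  refine Covers.exists_isCoverTime (n := n) fun v => ?_
  have hv := ZMod.val_lt v
  rcases hn with hn | hn
  · obtain ⟨k, hk, hkz⟩ := exists_netSteps_eq hs (n := n) (z := v.val - (m + 1)) (by omega)
    refine ⟨k, hk, ?_⟩
    rw [← ZMod.natCast_zmod_val v, ← Int.cast_natCast (R := ZMod (m + 1)),
      position_eq_intCast_iff, hkz]
    exact ⟨1, by ring⟩
  · obtain ⟨k, hk, hkz⟩ := exists_netSteps_eq hs (n := n) (z := v.val) (by omega)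
    refine ⟨k, hk, ?_⟩
    rw [← ZMod.natCast_zmod_val v, ← Int.cast_natCast (R := ZMod (m + 1)),
      position_eq_intCast_iff, hkz]
    exact ⟨0, by ring⟩

/-- From the cover time on, the return to vertex `0` is the end of a ruin problem on the universal
cover: the particle at `i` has to reach one of the adjacent lifts `0` and `m + 1` of vertex `0`. -/
theorem IsCoverTime.additionalSteps_eq (hs : ∀ k, ξ k ω = 1 ∨ ξ k ω = -1) {t i : ℕ}
    (ht : IsCoverTime m ξ ω t) (hi : i ∈ Finset.Icc 1 m)
    (hti : position m ξ t ω = (i : ZMod (m + 1))) :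
    additionalSteps m ξ ω = ruinDuration i (m + 1) (fun k => ξ (t + k)) ω := by
  rw [Finset.mem_Icc] at hi
  have key : ∀ n, (∃ s, IsCoverTime m ξ ω s ∧ position m ξ (s + n) ω = 0) ↔
      ((m : ℤ) + 1) ∣ i + netSteps (fun k => ξ (t + k)) n ω := by
    intro n
    have h1 : (∃ s, IsCoverTime m ξ ω s ∧ position m ξ (s + n) ω = 0) ↔
        position m ξ (t + n) ω = 0 :=
      ⟨fun ⟨s, hs, h⟩ => ht.unique hs ▸ h, fun h => ⟨t, ht, h⟩⟩
    have h2 : position m ξ (t + n) ω =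
        ((i + netSteps (fun k => ξ (t + k)) n ω : ℤ) : ZMod (m + 1)) := by
      rw [position, netSteps_add, Int.cast_add, Int.cast_add, Int.cast_natCast, ← hti]
      rfl
    rw [h1, h2, ZMod.intCast_zmod_eq_zero_iff_dvd]
    push_cast
    rfl
  apply le_antisymm
  · refine le_iInf₂ fun n hn => iInf₂_le n ((key n).2 ?_)
    push_cast at hn
    rcases hn with hn | hn <;> rw [hn]
    exact dvd_zero _
  · refine le_iInf₂ fun n hn => ?_
    rw [key] at hn
    have hout : i + netSteps (fun k => ξ (t + k)) n ω ≤ 0 ∨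
        (m : ℤ) + 1 ≤ i + netSteps (fun k => ξ (t + k)) n ω := by
      by_contra! hcon
      have := Int.eq_zero_of_dvd_of_nonneg_of_lt hcon.1.le hcon.2 hn
      omega
    have hz : ∃ z, (0 ≤ z ∧ z ≤ netSteps (fun k => ξ (t + k)) n ω ∨
        netSteps (fun k => ξ (t + k)) n ω ≤ z ∧ z ≤ 0) ∧ ((i : ℤ) + z = 0 ∨ (i : ℤ) + z = m + 1) := by
      rcases hout with h | h
      · exact ⟨-i, by omega, by omega⟩
      · exact ⟨m + 1 - i, by omega, by omega⟩
    obtain ⟨z, hz, hz'⟩ := hz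
    obtain ⟨k, hk, rfl⟩ := PolygonWalk.exists_netSteps_eq (fun k => hs (t + k)) hz
    exact (ruinDuration_le (by push_cast; exact hz')).trans (by exact_mod_cast hk)

end Paths

/-! ### The law of the last vertex and the expected return time -/

section Expectation

variable {Ω : Type*} [MeasurableSpace Ω] {P : Measure Ω} {p : ℝ} {ξ : ℕ → Ω → ℤ} {m : ℕ}

/-- The event that `t` is the cover time and that `v` is the vertex occupied at that time. -/
def coverEvent (m : ℕ) {Ω : Type*} (ξ : ℕ → Ω → ℤ) (t : ℕ) (v : ZMod (m + 1)) : Set Ω :=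
  {ω | IsCoverTime m ξ ω t ∧ position m ξ t ω = v}

theorem lastVertexEvent_eq_iUnion {Ω : Type*} (ξ : ℕ → Ω → ℤ) (v : ZMod (m + 1)) :
    lastVertexEvent m ξ v = ⋃ t, coverEvent m ξ t v := by
  ext ω
  simp [lastVertexEvent, coverEvent]

theorem mem_coverEvent_of_firstSteps {Ω : Type*} {ξ : ℕ → Ω → ℤ} {t : ℕ} {v : ZMod (m + 1)}
    (ω ω' : Ω) (h : ∀ k < t, ξ k ω = ξ k ω') (hω : ω ∈ coverEvent m ξ t v) :
    ω' ∈ coverEvent m ξ t v := by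
  have hpos : ∀ n ≤ t, position m ξ n ω = position m ξ n ω' := fun n hn => by
    rw [position, position, netSteps_congr fun k hk => h k (hk.trans_le hn)]
  have hcov : ∀ n ≤ t, Covers m ξ ω n ↔ Covers m ξ ω' n := fun n hn =>
    forall_congr' fun v => exists_congr fun k => and_congr_right fun hk => by
      rw [hpos k (hk.trans hn)]
  obtain ⟨h1, h2⟩ := hω
  rw [isCoverTime_iff] at h1
  exact ⟨isCoverTime_iff.2 ⟨(hcov t le_rfl).1 h1.1,
    fun n hn hc => h1.2 n hn ((hcov n hn.le).2 hc)⟩, (hpos t le_rfl) ▸ h2⟩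

theorem IsStepSequence.measurableSet_coverEvent (hξ : IsStepSequence P p ξ) (t : ℕ)
    (v : ZMod (m + 1)) : MeasurableSet (coverEvent m ξ t v) :=
  hξ.measurableSet_of_firstSteps mem_coverEvent_of_firstSteps

theorem IsStepSequence.measurableSet_lastVertexEvent (hξ : IsStepSequence P p ξ)
    (v : ZMod (m + 1)) : MeasurableSet (lastVertexEvent m ξ v) := by
  rw [lastVertexEvent_eq_iUnion]
  exact MeasurableSet.iUnion fun t => hξ.measurableSet_coverEvent t v

theorem pairwise_disjoint_coverEvent {Ω : Type*} (ξ : ℕ → Ω → ℤ) (v : ZMod (m + 1)) :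
    Pairwise (Function.onFun Disjoint fun t => coverEvent m ξ t v) := by
  intro s t hst
  rw [Function.onFun, Set.disjoint_left]
  exact fun ω h1 h2 => hst (h1.1.unique h2.1)

theorem pairwiseDisjoint_lastVertexEvent {Ω : Type*} (ξ : ℕ → Ω → ℤ) :
    Set.PairwiseDisjoint ((Finset.Icc 1 m : Finset ℕ) : Set ℕ)
      fun i : ℕ => lastVertexEvent m ξ (i : ZMod (m + 1)) := by
  intro i hi j hj hij
  rw [Function.onFun, Set.disjoint_left]
  rintro ω ⟨s, hs, hsi⟩ ⟨t, ht, htj⟩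
  obtain rfl := hs.unique ht
  exact hij (natCast_injOn_Icc hi hj (hsi.symm.trans htj))

/-- The walk almost surely covers the polygon, since its exit time from `(-(m + 1), m + 1)` has
finite expectation. -/
theorem IsStepSequence.ae_exists_isCoverTime [IsProbabilityMeasure P] (hξ : IsStepSequence P p ξ)
    (hp0 : 0 < p) (hp1 : p < 1) (m : ℕ) : ∀ᵐ ω ∂P, ∃ t, IsCoverTime m ξ ω t := by
  have h := hξ.expectedSteps_ruinDuration_ne_top hp0 hp1 (i := m + 1) (N := 2 * (m + 1)) (by omega)
  have hmeas : Measurable fun ω => (ruinDuration (m + 1) (2 * (m + 1)) ξ ω : ℝ≥0∞) :=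
    (measurable_ruinDuration_coords _ _).comp hξ.measurable_path
  filter_upwards [ae_lt_top hmeas h, hξ.ae_step] with ω hω hs
  exact exists_isCoverTime_of_ruinDuration_ne_top hs (ENat.toENNReal_lt_top.1 hω).ne

theorem IsStepSequence.ae_mem_biUnion_lastVertexEvent [IsProbabilityMeasure P]
    (hξ : IsStepSequence P p ξ) (hp0 : 0 < p) (hp1 : p < 1) (hm : 1 ≤ m) :
    ∀ᵐ ω ∂P, ω ∈ ⋃ i ∈ Finset.Icc 1 m, lastVertexEvent m ξ (i : ZMod (m + 1)) := by
  filter_upwards [hξ.ae_exists_isCoverTime hp0 hp1 m] with ω ⟨t, ht⟩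
  obtain ⟨i, hi, hti⟩ := exists_natCast_eq_of_ne_zero (ht.position_ne_zero hm)
  exact Set.mem_biUnion hi ⟨t, ht, hti⟩

theorem sum_Icc_pow_sub (r : ℝ) (m : ℕ) :
    ∑ i ∈ Finset.Icc 1 m, r ^ (m - i) = ∑ j ∈ Finset.range m, r ^ j := by
  refine Finset.sum_nbij' (fun i => m - i) (fun j => m - j) ?_ ?_ ?_ ?_ ?_ <;>
    intro i hi <;> simp only [Finset.mem_Icc, Finset.mem_range] at * <;> omega

/-- Each `lastVertexEvent` is contained in the difference of two successive ruin events. These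
differences have total probability `1`, and so do the events, so the probabilities agree. -/
theorem IsStepSequence.real_lastVertexEvent [IsProbabilityMeasure P] (hξ : IsStepSequence P p ξ)
    (hp0 : 0 < p) (hp1 : p < 1) {r : ℝ} (hr : r = (1 - p) / p) (hm : 1 ≤ m) {i : ℕ}
    (hi : i ∈ Finset.Icc 1 m) :
    P.real (lastVertexEvent m ξ (i : ZMod (m + 1)))
      = r ^ (m - i) / ∑ j ∈ Finset.range m, r ^ j := by
  have hr0 : 0 < r := by rw [hr]; exact div_pos (by linarith) hp0
  have hs := geom_sum_pos_of_pos hr0 (N := m) (by omega)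
  have hle : ∀ i ∈ Finset.Icc 1 m, P.real (lastVertexEvent m ξ (i : ZMod (m + 1)))
      ≤ r ^ (m - i) / ∑ j ∈ Finset.range m, r ^ j := by
    intro i hi
    have hi' := Finset.mem_Icc.1 hi
    have hsub : ∀ᵐ ω ∂P, ω ∈ lastVertexEvent m ξ (i : ZMod (m + 1)) →
        ω ∈ ruinWin (m + 1 - i) m ξ \ ruinWin (m - i) m ξ := by
      filter_upwards [hξ.ae_step] with ω hs ⟨t, ht, hti⟩
      exact ht.mem_ruinWin_diff hs hi hti
    have hmono : ∀ᵐ ω ∂P, ω ∈ ruinWin (m - i) m ξ → ω ∈ ruinWin (m + 1 - i) m ξ := by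
      filter_upwards [hξ.ae_step] with ω hs hω
      rw [Nat.sub_add_comm hi'.2]
      exact ruinWin_mono hs (by omega) hω
    have hdiff := measureReal_sdiff_add_inter (μ := P) (s := ruinWin (m + 1 - i) m ξ)
      (hξ.measurableSet_ruinWin (m - i) m)
    have hinter : P.real (ruinWin (m + 1 - i) m ξ ∩ ruinWin (m - i) m ξ)
        = P.real (ruinWin (m - i) m ξ) := by
      refine measureReal_congr (Filter.eventuallyEq_set.2 ?_)
      filter_upwards [hmono] with ω hω
      exact ⟨fun h => h.2, fun h => ⟨hω h, h⟩⟩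
    rw [hinter, hξ.real_ruinWin hp0 hp1 hr (by omega) (by omega),
      hξ.real_ruinWin hp0 hp1 hr (by omega) (by omega), Nat.sub_add_comm hi'.2,
      Finset.sum_range_succ, add_div] at hdiff
    have h1 : P.real (lastVertexEvent m ξ (i : ZMod (m + 1)))
        ≤ P.real (ruinWin (m + 1 - i) m ξ \ ruinWin (m - i) m ξ) :=
      ENNReal.toReal_mono (measure_ne_top _ _) (measure_mono_ae hsub)
    rw [Nat.sub_add_comm hi'.2] at h1
    linarith
  have hsum : ∑ i ∈ Finset.Icc 1 m, r ^ (m - i) / ∑ j ∈ Finset.range m, r ^ j = 1 := by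
    rw [← Finset.sum_div, sum_Icc_pow_sub, div_self hs.ne']
  have hone : (1 : ℝ) ≤ ∑ i ∈ Finset.Icc 1 m, P.real (lastVertexEvent m ξ (i : ZMod (m + 1))) := by
    have h := measureReal_biUnion_finset_le (μ := P) (Finset.Icc 1 m)
      fun i : ℕ => lastVertexEvent m ξ (i : ZMod (m + 1))
    have h1 : P (⋃ i ∈ Finset.Icc 1 m, lastVertexEvent m ξ (i : ZMod (m + 1))) = 1 :=
      (measure_congr (Filter.eventuallyEq_univ.2
        (hξ.ae_mem_biUnion_lastVertexEvent hp0 hp1 hm))).trans measure_univ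
    rwa [measureReal_def, h1, ENNReal.toReal_one] at h
  exact (Finset.sum_eq_sum_iff_of_le hle).1
    (le_antisymm (Finset.sum_le_sum hle) (hsum.trans_le hone)) i hi

/-- The strong Markov property at the cover time, in the form of a sum over its possible values. -/
theorem IsStepSequence.expectedSteps_additionalSteps [IsProbabilityMeasure P]
    (hξ : IsStepSequence P p ξ) (hp0 : 0 < p) (hp1 : p < 1) (hm : 1 ≤ m) :
    expectedSteps P (additionalSteps m ξ) =
      ∑ i ∈ Finset.Icc 1 m, P (lastVertexEvent m ξ (i : ZMod (m + 1))) *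
        expectedSteps P (ruinDuration i (m + 1) ξ) := by
  have hU : (⋃ i ∈ Finset.Icc 1 m, lastVertexEvent m ξ (i : ZMod (m + 1)) : Set Ω)
      =ᵐ[P] Set.univ :=
    Filter.eventuallyEq_univ.2 (hξ.ae_mem_biUnion_lastVertexEvent hp0 hp1 hm)
  rw [expectedSteps, ← setLIntegral_univ, ← setLIntegral_congr hU,
    lintegral_biUnion_finset (pairwiseDisjoint_lastVertexEvent ξ)
      fun i _ => hξ.measurableSet_lastVertexEvent _]
  refine Finset.sum_congr rfl fun i hi => ?_
  rw [lastVertexEvent_eq_iUnion,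
    lintegral_iUnion (fun t => hξ.measurableSet_coverEvent t _) (pairwise_disjoint_coverEvent ξ _),
    measure_iUnion (pairwise_disjoint_coverEvent ξ _) (fun t => hξ.measurableSet_coverEvent t _),
    ← ENNReal.tsum_mul_right]
  refine tsum_congr fun t => ?_
  rw [expectedSteps]
  refine Eq.trans ?_ (hξ.setLIntegral_shift (t := t) mem_coverEvent_of_firstSteps
    (measurable_ruinDuration_coords i (m + 1)))
  refine setLIntegral_congr_fun_ae (hξ.measurableSet_coverEvent t _) ?_
  filter_upwards [hξ.ae_step] with ω hs hω
  rw [hω.1.additionalSteps_eq hs hi hω.2]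
  rfl

end Expectation

/-! ### Evaluation of the sums -/

theorem sum_Icc_mul_sub (c : ℝ) (m : ℕ) :
    ∑ i ∈ Finset.Icc 1 m, (i : ℝ) * (c - i)
      = c * (m * (m + 1) / 2) - m * (m + 1) * (2 * m + 1) / 6 := by
  induction m with
  | zero => simp
  | succ m ih =>
    rw [Finset.sum_Icc_succ_top (by omega), ih]
    push_cast
    ring

theorem sub_one_mul_sum_Icc_pow_sub_mul (r : ℝ) (m : ℕ) :
    (r - 1) * ∑ i ∈ Finset.Icc 1 m, r ^ (m - i) * (i : ℝ)
      = r * ∑ j ∈ Finset.range m, r ^ j - m := by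
  induction m with
  | zero => simp
  | succ m ih =>
    have h : ∑ i ∈ Finset.Icc 1 m, r ^ (m + 1 - i) * (i : ℝ)
        = r * ∑ i ∈ Finset.Icc 1 m, r ^ (m - i) * (i : ℝ) := by
      rw [Finset.mul_sum]
      refine Finset.sum_congr rfl fun i hi => ?_
      rw [Nat.sub_add_comm (Finset.mem_Icc.1 hi).2, pow_succ]
      ring
    have hg := mul_geom_sum r m
    rw [Finset.sum_Icc_succ_top (by omega), h, Finset.sum_range_succ, Nat.sub_self, pow_zero]
    push_cast
    linear_combination r * ih + r * hg

theorem sum_Icc_pow_sub_mul_pow_sub_one (r : ℝ) (m : ℕ) :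
    ∑ i ∈ Finset.Icc 1 m, r ^ (m - i) * (r ^ i - 1)
      = m * r ^ m - ∑ j ∈ Finset.range m, r ^ j := by
  rw [← sum_Icc_pow_sub, ← nsmul_eq_mul]
  have h : ∀ i ∈ Finset.Icc 1 m, r ^ (m - i) * (r ^ i - 1) = r ^ m - r ^ (m - i) := by
    intro i hi
    rw [mul_sub, ← pow_add, Nat.sub_add_cancel (Finset.mem_Icc.1 hi).2, mul_one]
  rw [Finset.sum_congr rfl h, Finset.sum_sub_distrib, Finset.sum_const, Nat.card_Icc,
    Nat.add_sub_cancel]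

end PolygonWalk

theorem theorem4p1 {Ω : Type*} [MeasurableSpace Ω] (P : Measure Ω) [IsProbabilityMeasure P]
    (m : ℕ) (hm : 1 ≤ m) (p r : ℝ) (hp0 : 0 < p) (hp1 : p < 1) (hr : r = (1 - p) / p)
    (ξ : ℕ → Ω → ℤ) (hξ : PolygonWalk.IsStepSequence P p ξ) :
    PolygonWalk.expectedSteps P (PolygonWalk.additionalSteps m ξ) =
        ∑ i ∈ Finset.Icc 1 m, P (PolygonWalk.lastVertexEvent m ξ (i : ZMod (m + 1))) *
          PolygonWalk.expectedSteps P (PolygonWalk.ruinDuration i (m + 1) ξ) ∧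
      PolygonWalk.expectedSteps P (PolygonWalk.additionalSteps m ξ) ≠ ∞ ∧
      (PolygonWalk.expectedSteps P (PolygonWalk.additionalSteps m ξ)).toReal =
        if r = 1 then ((m : ℝ) + 1) * ((m : ℝ) + 2) / 6
        else (r + 1) / (r - 1) *
          (r / (r - 1) - (m : ℝ) * ((m : ℝ) + 2) / (r ^ m - 1)
            + ((m : ℝ) + 1) ^ 2 / (r ^ (m + 1) - 1)) := by
  have hsum := hξ.expectedSteps_additionalSteps hp0 hp1 hm
  have hfin : ∀ i ∈ Finset.Icc 1 m,
      P (PolygonWalk.lastVertexEvent m ξ (i : ZMod (m + 1))) *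
        PolygonWalk.expectedSteps P (PolygonWalk.ruinDuration i (m + 1) ξ) ≠ ∞ := fun i hi =>
    ENNReal.mul_ne_top (measure_ne_top _ _)
      (hξ.expectedSteps_ruinDuration_ne_top hp0 hp1 (by have := Finset.mem_Icc.1 hi; omega))
  refine ⟨hsum, by rw [hsum]; exact ENNReal.sum_ne_top.2 hfin, ?_⟩
  have hr0 : 0 < r := by rw [hr]; exact div_pos (by linarith) hp0
  have hm0 : m ≠ 0 := by omega
  have hreal : (PolygonWalk.expectedSteps P (PolygonWalk.additionalSteps m ξ)).toReal =
      (∑ i ∈ Finset.Icc 1 m, r ^ (m - i) *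
        (PolygonWalk.expectedSteps P (PolygonWalk.ruinDuration i (m + 1) ξ)).toReal) /
        ∑ j ∈ Finset.range m, r ^ j := by
    rw [hsum, ENNReal.toReal_sum hfin, Finset.sum_div]
    refine Finset.sum_congr rfl fun i hi => ?_
    rw [ENNReal.toReal_mul, ← measureReal_def, hξ.real_lastVertexEvent hp0 hp1 hr hm hi]
    ring
  rw [hreal]
  split_ifs with h1
  · have hp : p = 1 / 2 := by
      rw [h1, eq_div_iff hp0.ne'] at hr
      linarith
    have h2 : ∀ i ∈ Finset.Icc 1 m, r ^ (m - i) *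
        (PolygonWalk.expectedSteps P (PolygonWalk.ruinDuration i (m + 1) ξ)).toReal
        = (i : ℝ) * (((m : ℝ) + 1) - i) := by
      intro i hi
      rw [hξ.toReal_expectedSteps_ruinDuration_symm hp
        (by have := Finset.mem_Icc.1 hi; omega), h1, one_pow, one_mul]
      push_cast
      rfl
    rw [Finset.sum_congr rfl h2, PolygonWalk.sum_Icc_mul_sub, h1]
    simp only [one_pow, Finset.sum_const, Finset.card_range, nsmul_eq_mul, mul_one]
    have hmR : (m : ℝ) ≠ 0 := Nat.cast_ne_zero.2 hm0
    field_simp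
    ring
  · have hne : ∀ n : ℕ, n ≠ 0 → r ^ n - 1 ≠ 0 := fun n hn =>
      sub_ne_zero.2 fun h => h1 ((pow_eq_one_iff_of_nonneg hr0.le hn).1 h)
    have hr1 : r - 1 ≠ 0 := sub_ne_zero.2 h1
    have h2 : ∀ i ∈ Finset.Icc 1 m, r ^ (m - i) *
        (PolygonWalk.expectedSteps P (PolygonWalk.ruinDuration i (m + 1) ξ)).toReal
        = (r + 1) / (r - 1) * (r ^ (m - i) * i -
          (m + 1) / (r ^ (m + 1) - 1) * (r ^ (m - i) * (r ^ i - 1))) := by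
      intro i hi
      rw [hξ.toReal_expectedSteps_ruinDuration_asymm hp0 hp1 hr h1 (Nat.add_one_ne_zero m)
        (by have := Finset.mem_Icc.1 hi; omega)]
      push_cast
      ring
    have hT := PolygonWalk.sub_one_mul_sum_Icc_pow_sub_mul r m
    rw [mul_comm, ← eq_div_iff hr1] at hT
    rw [Finset.sum_congr rfl h2, ← Finset.mul_sum, Finset.sum_sub_distrib, ← Finset.mul_sum,
      PolygonWalk.sum_Icc_pow_sub_mul_pow_sub_one, hT, geom_sum_eq h1]
    have ha := hne m hm0
    have hb := hne (m + 1) (Nat.add_one_ne_zero m)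
    rw [pow_succ'] at hb ⊢
    generalize r ^ m = a at ha hb ⊢
    field_simp
    ring
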